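/- Let $\ell^2=\ell^2(\mathbb N)$, $\ell^\infty=\ell^\infty(\mathbb N)$ (complex sequences) and let $\mathcal B=\mathcal B(\ell^2)$ be the algebra of bounded operators. For $\alpha\in\ell^\infty$ let $\operatorname{diag}(\alpha)\in\mathcal B$ be the operator $\xi\mapsto(\alpha_n\xi_n)_n$. Let $\mathrm{Emb}$ be the set of all injective maps $f:\operatorname{dom} f\to\mathbb N$ with $\operatorname{dom} f\subseteq\mathbb N$. For $f\in\mathrm{Emb}$ let $U_f\in\mathcal B$ be the partial isometry with $(U_f\xi)_m=\xi_n$ if $m=f(n)$, $n \in\operatorname{dom} f$, and $(U_f\xi)_m=0$ if $m\notin\operatorname{ran} f$, and for $\alpha\in\ell^\infty$ let $f_*(\alpha)\in\ell^\infty$ be the sequence with $f_*(\alpha)_m=\alpha_n$ if $m=f(n)$, $n \in\operatorname{dom} f$, and $f_*(\alpha)_m=0$ if $m\notin\operatorname{ran} f$. An ideal $S$ of $\ell^\infty$ (possibly $0$ or $\ell^\infty$) is called symmetric if $f_*(\alpha)\in S$ for all $\alpha\in S$ and $f\in\mathrm{Emb}$. Let $$\Gamma^\infty=\operatorname{span}\{\operatorname{diag}(\alpha)U_f:\alpha\in\ell^\infty,\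 f\in\mathrm{Emb}\},$$ which is a unital subalgebra of $\mathcal B$. For a symmetric ideal $S$ of $\ell^\infty$ let $$I_S=\operatorname{span}\{\operatorname{diag}(\alpha)U_f:\alpha\in S,\ f\in\mathrm{Emb}\},$$ which is a two-sided ideal of $\Gamma^\infty$, and let $J_S$ be the two-sided ideal of $\mathcal B$ generated by $\{\operatorname{diag}(\alpha):\alpha\in S\}$. Then: (i) The map $S\mapsto I_S$ is a bijection from the set of symmetric ideals of $\ell^\infty$ onto the set of two-sided ideals of $\Gamma^\infty$. Its inverse maps a two-sided ideal $I$ of $\Gamma^\infty$ to the symmetric ideal $S(I)=\{\alpha\in\ell^\infty:\operatorname{diag}(\alpha)\in I\}$. (ii) The map $J\mapsto J\cap\Gamma^\infty$ is a bijection from the set of two-sided ideals of $\mathcal B$ onto the set of two-sided ideals of $\Gamma^\infty$. Its inverse maps a two-sided ideal $I$ of $\Gamma^\infty$ to the two-sided ideal of $\mathcal B$ generated by $I$. (iii) For every symmetric ideal $S$ of $\ell^\infty$, $J_S\cap\Gamma^\infty=I_S$. -/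

import Mathlib

open scoped ENNReal

namespace GammaInfty

/-- `ℓ²(ℕ)`, the Hilbert space of square-summable complex sequences. -/
abbrev EllTwo : Type := lp (fun _ : ℕ => ℂ) 2

/-- `ℓ^∞(ℕ)`, the commutative algebra of bounded complex sequences with the pointwise operations. -/
abbrev EllInfty : Type := lp (fun _ : ℕ => ℂ) ∞

/-- The algebra of bounded linear operators on `ℓ²`; its multiplication is composition. -/
abbrev BoundedOps : Type := EllTwo →L[ℂ] EllTwo

/-- The monoid of partially defined injections `ℕ ⊇ dom f → ℕ`: `f n = some m` means that
`n ∈ dom f` and `f(n) = m`; `f.symm` is the partially defined inverse. The composite "first `g`,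
then `f`" is `g.trans f`. -/
abbrev Emb : Type := ℕ ≃. ℕ

/-- The pushforward of a sequence along a partial injection:
`(f_* a)_m = a_n` if `m = f(n)`, and `0` if `m ∉ ran f`. -/
def pushFun (f : Emb) (a : ℕ → ℂ) : ℕ → ℂ := fun m => (f.symm m).elim 0 a

theorem sum_pushFun_le (f : Emb) (x : EllTwo) (s : Finset ℕ) :
    ∑ m ∈ s, ‖pushFun f x m‖ ^ (2 : ℝ≥0∞).toReal ≤ ‖x‖ ^ (2 : ℝ≥0∞).toReal := by
  have h2 : 0 < (2 : ℝ≥0∞).toReal := by norm_num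
  have key : ∑ m ∈ s, ‖pushFun f x m‖ ^ (2 : ℝ≥0∞).toReal
      = ∑ n ∈ s.filterMap f.symm (fun a b c ha hb => f.symm.inj ha hb),
        ‖x n‖ ^ (2 : ℝ≥0∞).toReal := by
    classical
    induction s using Finset.induction_on with
    | empty => simp
    | insert a s ha ih =>
      rw [Finset.sum_insert ha, ih]
      cases h : f.symm a with
      | none =>
        have : (insert a s).filterMap f.symm (fun a b c ha hb => f.symm.inj ha hb)
            = s.filterMap f.symm (fun a b c ha hb => f.symm.inj ha hb) := by
          ext n; simp [h]
        rw [this]; simp [pushFun, h]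
      | some b =>
        have : (insert a s).filterMap f.symm (fun a b c ha hb => f.symm.inj ha hb)
            = insert b (s.filterMap f.symm (fun a b c ha hb => f.symm.inj ha hb)) := by
          ext n; simp [h, eq_comm]
        rw [this, Finset.sum_insert]
        · simp [pushFun, h]
        · simp only [Finset.mem_filterMap, not_exists, not_and]
          intro c hc hcb
          have : c = a := f.symm.inj hcb h
          exact ha (this ▸ hc)
  rw [key]
  exact lp.sum_rpow_le_norm_rpow h2 x _

theorem pushFun_add (f : Emb) (a b : ℕ → ℂ) : pushFun f (a + b) = pushFun f a + pushFun f b := by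
  funext m; simp only [pushFun, Pi.add_apply]; cases f.symm m <;> simp

theorem pushFun_smul (f : Emb) (c : ℂ) (a : ℕ → ℂ) : pushFun f (c • a) = c • pushFun f a := by
  funext m; simp only [pushFun, Pi.smul_apply]; cases f.symm m <;> simp

/-- The partial isometry `U_f` of `ℓ²`: `(U_f ξ)_m = ξ_n` if `f(n) = m`, and `0` if `m ∉ ran f`.
Thus `U_f e_n = e_{f(n)}` for `n ∈ dom f`, and `U_f e_n = 0` otherwise. -/
noncomputable def U (f : Emb) : BoundedOps :=
  LinearMap.mkContinuous
    { toFun := fun x => ⟨pushFun f x, memℓp_gen' (sum_pushFun_le f x)⟩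
      map_add' := fun x y => Subtype.ext (pushFun_add f x y)
      map_smul' := fun c x => Subtype.ext (pushFun_smul f c x) }
    1 (fun x => by
      rw [one_mul]
      exact lp.norm_le_of_forall_sum_le (by norm_num) (norm_nonneg _) (sum_pushFun_le f x))

/-- The action `f_*` of the partial injections on `ℓ^∞`. -/
noncomputable def push (f : Emb) (a : EllInfty) : EllInfty :=
  ⟨pushFun f a, memℓp_infty ⟨‖a‖, by
    rintro _ ⟨m, rfl⟩
    simp only [pushFun]
    cases f.symm m with
    | none => simp
    | some n => exact lp.norm_apply_le_norm ENNReal.top_ne_zero a n⟩⟩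

theorem sum_mul_le (a : EllInfty) (x : EllTwo) (s : Finset ℕ) :
    ∑ n ∈ s, ‖a n * x n‖ ^ (2 : ℝ≥0∞).toReal ≤ (‖a‖ * ‖x‖) ^ (2 : ℝ≥0∞).toReal := by
  have h2 : 0 < (2 : ℝ≥0∞).toReal := by norm_num
  rw [Real.mul_rpow (norm_nonneg _) (norm_nonneg _)]
  refine le_trans ?_ (mul_le_mul_of_nonneg_left (lp.sum_rpow_le_norm_rpow h2 x s) (by positivity))
  rw [Finset.mul_sum]
  refine Finset.sum_le_sum fun n _ => ?_
  rw [norm_mul, Real.mul_rpow (norm_nonneg _) (norm_nonneg _)]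
  gcongr
  exact lp.norm_apply_le_norm ENNReal.top_ne_zero a n

/-- The diagonal operator `diag(a) ξ = (a_n ξ_n)_n` on `ℓ²` of a bounded sequence `a`. -/
noncomputable def diag (a : EllInfty) : BoundedOps :=
  LinearMap.mkContinuous
    { toFun := fun x => ⟨fun n => a n * x n, memℓp_gen' (sum_mul_le a x)⟩
      map_add' := fun x y => Subtype.ext (funext fun n => mul_add (a n) (x n) (y n))
      map_smul' := fun c x => Subtype.ext (funext fun n => mul_left_comm (a n) c (x n)) }
    ‖a‖ (fun x => lp.norm_le_of_forall_sum_le (by norm_num) (by positivity) (sum_mul_le a x))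

theorem U_apply (f : Emb) (x : EllTwo) (m : ℕ) : U f x m = (f.symm m).elim 0 x := rfl

theorem push_apply (f : Emb) (a : EllInfty) (m : ℕ) : push f a m = (f.symm m).elim 0 a := rfl

theorem diag_apply (a : EllInfty) (x : EllTwo) (n : ℕ) : diag a x n = a n * x n := rfl

theorem ops_ext {A B : BoundedOps} (h : ∀ x n, A x n = B x n) : A = B :=
  ContinuousLinearMap.ext fun x => lp.ext (funext (h x))

theorem U_refl : U (PEquiv.refl ℕ) = 1 := ops_ext fun _ _ => rfl

theorem diag_one : diag 1 = 1 := ops_ext fun x n => one_mul (x n)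

theorem diag_zero : diag 0 = 0 := ops_ext fun x n => zero_mul (x n)

theorem diag_add (a b : EllInfty) : diag (a + b) = diag a + diag b :=
  ops_ext fun x n => add_mul (a n) (b n) (x n)

theorem diag_mul (a b : EllInfty) : diag (a * b) = diag a * diag b :=
  ops_ext fun x n => mul_assoc (a n) (b n) (x n)

theorem U_mul (f g : Emb) : U f * U g = U (g.trans f) := by
  refine ops_ext fun x n => ?_
  change (f.symm n).elim 0 (fun k => U g x k) = ((g.trans f).symm n).elim 0 x
  rw [PEquiv.symm_trans_rev]
  change _ = ((f.symm n).bind g.symm).elim 0 x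
  cases h : f.symm n with
  | none => simp
  | some k => simp [U_apply]

theorem U_mul_diag (f : Emb) (a : EllInfty) : U f * diag a = diag (push f a) * U f := by
  refine ops_ext fun x n => ?_
  change (f.symm n).elim 0 (fun k => diag a x k) = push f a n * U f x n
  rw [push_apply, U_apply]
  cases h : f.symm n with
  | none => simp
  | some k => simp [diag_apply]

theorem diag_push (f : Emb) (a : EllInfty) : diag (push f a) = U f * diag a * U f.symm := by
  refine ops_ext fun x n => ?_
  change push f a n * x n = (f.symm n).elim 0 (fun k => a k * (f.symm.symm k).elim 0 x)
  rw [push_apply]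
  cases h : f.symm n with
  | none => simp
  | some k =>
    have : f k = some n := (PEquiv.eq_some_iff f).1 h
    simp [this]

/-- `span {diag(a) U_f : a ∈ S, f a partial injection}`, a linear subspace of the bounded
operators. -/
noncomputable def diagSpan (S : Set EllInfty) : Submodule ℂ BoundedOps :=
  Submodule.span ℂ {T | ∃ a ∈ S, ∃ f : Emb, T = diag a * U f}

/-- An ideal of `ℓ^∞` is symmetric if it is invariant under `f_*` for every partial injection. -/
def IsSymmetric (S : Ideal EllInfty) : Prop :=
  ∀ f : Emb, ∀ a ∈ S, push f a ∈ S

/-- The symmetric ideals of `ℓ^∞` (including `0` and `ℓ^∞` itself). -/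
abbrev SymmetricIdeal : Type := {S : Ideal EllInfty // IsSymmetric S}

theorem isSymmetric_top : IsSymmetric ⊤ := fun _ _ _ => trivial

theorem mul_mem_diagSpan_left {S : Ideal EllInfty} (hS : IsSymmetric S) {x y : BoundedOps}
    (hx : x ∈ diagSpan Set.univ) (hy : y ∈ diagSpan S) : x * y ∈ diagSpan S := by
  refine Submodule.span_induction₂ (p := fun x y _ _ => x * y ∈ diagSpan S) ?_ ?_ ?_ ?_ ?_ ?_ ?_
    hx hy
  · rintro _ _ ⟨a, -, f, rfl⟩ ⟨b, hb, g, rfl⟩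
    have : diag a * U f * (diag b * U g) = diag (a * push f b) * U (g.trans f) := by
      rw [diag_mul, ← U_mul, mul_assoc, ← mul_assoc (U f), U_mul_diag]; simp only [mul_assoc]
    rw [this]
    exact Submodule.subset_span ⟨_, S.mul_mem_left a (hS f b hb), _, rfl⟩
  · intro y _; simp
  · intro x _; simp
  · intro x y z _ _ _ h1 h2; rw [add_mul]; exact add_mem h1 h2
  · intro x y z _ _ _ h1 h2; rw [mul_add]; exact add_mem h1 h2
  · intro c x y _ _ h; rw [smul_mul_assoc]; exact Submodule.smul_mem _ c h
  · intro c x y _ _ h; rw [mul_smul_comm]; exact Submodule.smul_mem _ c h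

theorem mul_mem_diagSpan_right {S : Ideal EllInfty} {x y : BoundedOps}
    (hx : x ∈ diagSpan S) (hy : y ∈ diagSpan Set.univ) : x * y ∈ diagSpan S := by
  refine Submodule.span_induction₂ (p := fun x y _ _ => x * y ∈ diagSpan S) ?_ ?_ ?_ ?_ ?_ ?_ ?_
    hx hy
  · rintro _ _ ⟨a, ha, f, rfl⟩ ⟨b, -, g, rfl⟩
    have : diag a * U f * (diag b * U g) = diag (a * push f b) * U (g.trans f) := by
      rw [diag_mul, ← U_mul, mul_assoc, ← mul_assoc (U f), U_mul_diag]; simp only [mul_assoc]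
    rw [this]
    exact Submodule.subset_span ⟨_, S.mul_mem_right _ ha, _, rfl⟩
  · intro y _; simp
  · intro x _; simp
  · intro x y z _ _ _ h1 h2; rw [add_mul]; exact add_mem h1 h2
  · intro x y z _ _ _ h1 h2; rw [mul_add]; exact add_mem h1 h2
  · intro c x y _ _ h; rw [smul_mul_assoc]; exact Submodule.smul_mem _ c h
  · intro c x y _ _ h; rw [mul_smul_comm]; exact Submodule.smul_mem _ c h

theorem diag_mul_U_mem (a : EllInfty) (f : Emb) : diag a * U f ∈ diagSpan Set.univ :=
  Submodule.subset_span ⟨a, trivial, f, rfl⟩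

theorem diag_mem (a : EllInfty) : diag a ∈ diagSpan Set.univ := by
  simpa [U_refl] using diag_mul_U_mem a (PEquiv.refl ℕ)

theorem U_mem (f : Emb) : U f ∈ diagSpan Set.univ := by
  simpa [diag_one] using diag_mul_U_mem 1 f

/-- The algebra `Γ^∞ = span {diag(a) U_f : a ∈ ℓ^∞, f a partial injection}` of operators. -/
noncomputable def Gam : Subalgebra ℂ BoundedOps :=
  (diagSpan Set.univ).toSubalgebra (by simpa [diag_one] using diag_mem 1)
    (fun _ _ hx hy => mul_mem_diagSpan_right (S := ⊤) hx hy)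

/-- `diag(a)` as an element of `Γ^∞`. -/
noncomputable def diagGam (a : EllInfty) : Gam := ⟨diag a, diag_mem a⟩

/-- `I_S = span {diag(a) U_f : a ∈ S, f a partial injection}` as a two-sided ideal of `Γ^∞`, for a
symmetric ideal `S` of `ℓ^∞`. -/
noncomputable def idealI (S : SymmetricIdeal) : TwoSidedIdeal Gam :=
  TwoSidedIdeal.mk' {T : Gam | (T : BoundedOps) ∈ diagSpan (S.1 : Set EllInfty)}
    (zero_mem (diagSpan (S.1 : Set EllInfty)))
    (fun {x y} hx hy => (diagSpan (S.1 : Set EllInfty)).add_mem (x := (x : BoundedOps)) (y := y) hx hy)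
    (fun {x} hx => (diagSpan (S.1 : Set EllInfty)).neg_mem (x := (x : BoundedOps)) hx)
    (fun {x _} hy => mul_mem_diagSpan_left S.2 x.2 hy)
    (fun {_ y} hx => mul_mem_diagSpan_right hx y.2)

/-- `S(I) = {a ∈ ℓ^∞ : diag(a) ∈ I}` as a symmetric ideal of `ℓ^∞`, for a two-sided ideal `I` of
`Γ^∞`. -/
noncomputable def symI (I : TwoSidedIdeal Gam) : SymmetricIdeal :=
  ⟨{ carrier := {a | diagGam a ∈ I}
     zero_mem' := by
       have : diagGam 0 = 0 := Subtype.ext diag_zero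
       simp [this]
     add_mem' := fun {a b} ha hb => by
       have : diagGam (a + b) = diagGam a + diagGam b := Subtype.ext (diag_add a b)
       simp only [Set.mem_ofPred_eq] at *
       rw [this]; exact I.add_mem ha hb
     smul_mem' := fun c a ha => by
       have : diagGam (c • a) = diagGam c * diagGam a := Subtype.ext (diag_mul c a)
       simp only [Set.mem_ofPred_eq] at *
       rw [this]; exact I.mul_mem_left _ _ ha },
   fun f a ha => by
     have : diagGam (push f a) = ⟨U f, U_mem f⟩ * diagGam a * ⟨U f.symm, U_mem f.symm⟩ :=
       Subtype.ext (diag_push f a)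
     change diagGam (push f a) ∈ I
     rw [this]; exact I.mul_mem_right _ _ (I.mul_mem_left _ _ ha)⟩

/-- `J_S = ⟨diag(a) : a ∈ S⟩`, the two-sided ideal of the algebra of bounded operators generated by
`diag(S)`. -/
noncomputable def idealJ (S : SymmetricIdeal) : TwoSidedIdeal BoundedOps :=
  TwoSidedIdeal.span (diag '' (S.1 : Set EllInfty))

/-- `J ∩ Γ^∞` as a two-sided ideal of `Γ^∞`. -/
noncomputable def restrict (J : TwoSidedIdeal BoundedOps) : TwoSidedIdeal Gam :=
  TwoSidedIdeal.comap Gam.val J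

/-- The two-sided ideal of the algebra of bounded operators generated by an ideal of `Γ^∞`. -/
noncomputable def generate (I : TwoSidedIdeal Gam) : TwoSidedIdeal BoundedOps :=
  TwoSidedIdeal.span {T | ∃ x ∈ I, (x : BoundedOps) = T}

end GammaInfty

namespace GammaInfty

universe u

/-! Everything is reduced to diagonal operators.

For (i), the main diagonal of an element of `I_S` lies in `S`, which recovers `S`
(`diag_mem_diagSpan_iff`). Conversely, the matrix of an element `T` of `Γ^∞` is supported on
finitely many graphs of partial injections. Colouring rows and columns by finitely many colours cuts
`T` into blocks `diag(b) U_h` with `diag(b)` again in the ideal generated by `T`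
(`exists_sum_compressions`). So an ideal of `Γ^∞` is determined by its diagonal operators.

For (iii) it then suffices that `diag(α) ∈ J_S` forces `α ∈ S` (`mem_of_diag_mem_idealJ`). If
`diag(α) = ∑ A_i diag(γ_i) B_i`, a dimension count bounds the number of large entries of `α` by a
multiple of the number of large entries of `∑ |γ_i|`. Hall's marriage theorem turns this bound into
domination by finitely many pushforwards (`mem_of_card_le`).

For (ii), restricting a generated ideal gives nothing new by (i) and (iii). Conversely, a compact `T
∈ J` and the diagonal operator of its singular values generate the same ideal
(`exists_diag_of_compact`), while a non-compact `T ∈ J` forces `1 ∈ J` (`one_mem_of_not_compact`).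
-/

/-! ### Solidity and rearrangement in symmetric ideals of `ℓ^∞`. -/

/-- The element of `ℓ^∞` given by a sequence with an explicit bound. -/
noncomputable def ofBound (a : ℕ → ℂ) (C : ℝ) (h : ∀ n, ‖a n‖ ≤ C) : EllInfty :=
  ⟨a, memℓp_infty ⟨C, by rintro _ ⟨n, rfl⟩; exact h n⟩⟩

@[simp] theorem ofBound_apply (a : ℕ → ℂ) (C : ℝ) (h : ∀ n, ‖a n‖ ≤ C) (n : ℕ) :
    ofBound a C h n = a n := rfl

theorem sum_apply_infty {ι : Type*} (s : Finset ι) (a : ι → EllInfty) (n : ℕ) :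
    (∑ i ∈ s, a i) n = ∑ i ∈ s, a i n := by
  classical
  induction s using Finset.induction_on with
  | empty => simp
  | insert i s hi ih => rw [Finset.sum_insert hi, Finset.sum_insert hi, ← ih]; rfl

theorem mul_apply_infty (a b : EllInfty) (n : ℕ) : (a * b) n = a n * b n := rfl

/-- Multiplying by the phases `v i` turns each `γ i` into its modulus, and the quotient of `α` by
the sum of the moduli is a bounded multiplier. Where that sum vanishes, so does `α`, and the
quotient is `0` by convention. -/
theorem mem_of_norm_le_sum (S : Ideal EllInfty) {ι : Type*} [Fintype ι] {γ : ι → EllInfty}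
    (hγ : ∀ i, γ i ∈ S) {α : EllInfty} {C : ℝ} (hC : 0 ≤ C)
    (h : ∀ n, ‖α n‖ ≤ C * ∑ i, ‖γ i n‖) : α ∈ S := by
  set v : ι → EllInfty := fun i => ofBound (fun n => star (γ i n) / ‖γ i n‖) 1 (fun n => by
    simpa using div_self_le_one ‖γ i n‖) with hv
  have hvn : ∀ i n, (v i * γ i) n = ‖γ i n‖ := by
    intro i n
    rw [mul_apply_infty, hv, ofBound_apply]
    by_cases h0 : γ i n = 0
    · simp [h0]
    · have : (‖γ i n‖ : ℂ) ≠ 0 := by simpa using h0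
      rw [div_mul_eq_mul_div, div_eq_iff this, ← sq]
      exact (Complex.conj_mul' _)
  have hδ : ∀ n, (∑ i, v i * γ i) n = ((∑ i, ‖γ i n‖ : ℝ) : ℂ) := by
    intro n; rw [sum_apply_infty]; push_cast; exact Finset.sum_congr rfl fun i _ => hvn i n
  have hnn : ∀ n, 0 ≤ ∑ i, ‖γ i n‖ := fun n => Finset.sum_nonneg fun i _ => norm_nonneg _
  have hw : ∀ n, ‖α n / ((∑ i, ‖γ i n‖ : ℝ) : ℂ)‖ ≤ C := by
    intro n
    rw [norm_div, Complex.norm_of_nonneg (hnn n)]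
    exact div_le_of_le_mul₀ (hnn n) hC (h n)
  have : α = ofBound _ C hw * ∑ i, v i * γ i := by
    refine lp.ext (funext fun n => ?_)
    rw [mul_apply_infty, ofBound_apply, hδ]
    by_cases h0 : (∑ i, ‖γ i n‖ : ℝ) = 0
    · have := h n
      rw [h0, mul_zero, norm_le_zero_iff] at this
      simp [this]
    · rw [div_mul_cancel₀]; exact Complex.ofReal_ne_zero.2 h0
  rw [this]
  exact S.mul_mem_left _ (S.sum_mem fun i _ => S.mul_mem_left _ (hγ i))

theorem mem_of_norm_le (S : Ideal EllInfty) {α γ : EllInfty} (hγ : γ ∈ S) {C : ℝ} (hC : 0 ≤ C)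
    (h : ∀ n, ‖α n‖ ≤ C * ‖γ n‖) : α ∈ S :=
  mem_of_norm_le_sum S (ι := Unit) (γ := fun _ => γ) (fun _ => hγ) hC (by simpa using h)

open Classical in
/-- The partial injection with graph `R`. -/
noncomputable def embOfRel (R : ℕ → ℕ → Prop) (h₁ : ∀ n m m', R n m → R n m' → m = m')
    (h₂ : ∀ n n' m, R n m → R n' m → n = n') : Emb where
  toFun n := if h : ∃ m, R n m then some h.choose else none
  invFun m := if h : ∃ n, R n m then some h.choose else none
  inv n m := by
    have e₁ : (m ∈ if h : ∃ m, R n m then some h.choose else none) ↔ R n m := by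
      split_ifs with h
      · rw [Option.mem_some_iff]
        exact ⟨fun e => e ▸ h.choose_spec, fun e => h₁ _ _ _ h.choose_spec e⟩
      · simpa using fun e => h ⟨m, e⟩
    have e₂ : (n ∈ if h : ∃ n, R n m then some h.choose else none) ↔ R n m := by
      split_ifs with h
      · rw [Option.mem_some_iff]
        exact ⟨fun e => e ▸ h.choose_spec, fun e => h₂ _ _ _ h.choose_spec e⟩
      · simpa using fun e => h ⟨n, e⟩
    exact e₂.trans e₁.symm

theorem embOfRel_eq_some {R : ℕ → ℕ → Prop} {h₁ : ∀ n m m', R n m → R n m' → m = m'}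
    {h₂ : ∀ n n' m, R n m → R n' m → n = n'} {n m : ℕ} :
    embOfRel R h₁ h₂ n = some m ↔ R n m := by
  classical
  change (if h : ∃ m, R n m then some h.choose else none) = some m ↔ _
  split_ifs with h
  · rw [Option.some_inj]
    exact ⟨fun e => e ▸ h.choose_spec, fun e => h₁ _ _ _ h.choose_spec e⟩
  · simpa using fun e => h ⟨m, e⟩

theorem push_apply_of_eq_some {f : Emb} {n m : ℕ} (h : f n = some m) (a : EllInfty) :
    push f a m = a n := by
  rw [push_apply, (PEquiv.eq_some_iff f).2 h]; rfl

/-- Enumerating the set where `γ` is large pushes `γ` forward to a sequence bounded away from `0` at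
every index. -/
theorem one_mem_of_infinite {S : Ideal EllInfty} (hS : IsSymmetric S) {γ : EllInfty} (hγ : γ ∈ S)
    {t : ℝ} (ht : 0 < t) (hinf : {n | t < ‖γ n‖}.Infinite) : (1 : EllInfty) ∈ S := by
  have := hinf.to_subtype
  let e := Nat.Subtype.orderIsoOfNat {n | t < ‖γ n‖}
  let f : Emb := embOfRel (fun n m => ((e m : {n | t < ‖γ n‖}) : ℕ) = n)
    (fun n m m' h h' => e.injective (Subtype.ext (h.trans h'.symm)))
    (fun n n' m h h' => h.symm.trans h')
  refine mem_of_norm_le S (hS f γ hγ) (C := t⁻¹) (by positivity) fun m => ?_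
  rw [push_apply_of_eq_some (f := f) (embOfRel_eq_some.2 rfl)]
  have : t < ‖γ (e m : {n | t < ‖γ n‖})‖ := (e m).2
  change ‖(1 : ℂ)‖ ≤ _
  rw [norm_one, inv_mul_eq_div, one_le_div ht]
  exact this.le

/-- Domination of the distribution function of `α` by that of an element of a symmetric ideal,
up to dilations, implies membership. -/
theorem mem_of_card_le {S : Ideal EllInfty} (hS : IsSymmetric S) {α γ : EllInfty} (hγ : γ ∈ S)
    {k : ℕ} {C : ℝ} (hC : 0 < C)
    (h : ∀ t > 0, ∀ F : Finset ℕ, (∀ n ∉ F, ‖γ n‖ ≤ t) →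
      ∀ s : Finset ℕ, (∀ n ∈ s, C * t < ‖α n‖) → s.card ≤ k * F.card) : α ∈ S := by
  by_cases hfin : ∀ t : ℝ, 0 < t → {n | t < ‖γ n‖}.Finite
  swap
  · push Not at hfin
    obtain ⟨t, ht, hinf⟩ := hfin
    rw [(Ideal.eq_top_iff_one S).2 (one_mem_of_infinite hS hγ ht hinf)]
    trivial
  let X := {n // α n ≠ 0}
  -- The factor `2` makes the strict hypothesis of `h` hold at the minimal index `n₀` itself.
  have hpos : ∀ n : X, 0 < ‖α n‖ / (2 * C) := fun n => by
    have := norm_pos_iff.2 n.2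
    positivity
  let F : X → Finset ℕ := fun n => (hfin _ (hpos n)).toFinset
  have hF : ∀ n m, m ∈ F n ↔ ‖α n‖ / (2 * C) < ‖γ m‖ := fun n m => by simp [F]
  -- Hall's theorem matches the support of `α` injectively with `k` copies of the indices of `γ`.
  -- The sets `F n` grow as `‖α n‖` shrinks, so Hall's condition for `s` only concerns the index of
  -- `s` where `‖α n‖` is least.
  obtain ⟨φ, hφ, hφF⟩ := (Finset.all_card_le_biUnion_card_iff_exists_injective
    (fun n : X => F n ×ˢ (Finset.univ : Finset (Fin k)))).1 (by
      intro s
      rcases s.eq_empty_or_nonempty with rfl | hs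
      · simp
      obtain ⟨n₀, hn₀, hmin⟩ := s.exists_min_image (fun n : X => ‖α n‖) hs
      calc s.card = (s.map (Function.Embedding.subtype _)).card := (Finset.card_map _).symm
        _ ≤ k * (F n₀).card := by
          refine h (‖α n₀‖ / (2 * C)) (hpos n₀) (F n₀) (fun n hn => ?_) _ fun n hn => ?_
          · rw [hF] at hn; exact not_lt.1 hn
          · obtain ⟨n', hn', rfl⟩ := Finset.mem_map.1 hn
            have h1 := hmin n' hn'
            have h2 := norm_pos_iff.2 n₀.2
            have h3 : C * (‖α n₀‖ / (2 * C)) = ‖α n₀‖ / 2 := by field_simp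
            rw [h3]
            exact (half_lt_self h2).trans_le h1
        _ = (F n₀ ×ˢ (Finset.univ : Finset (Fin k))).card := by
          rw [Finset.card_product, Finset.card_univ, Fintype.card_fin, mul_comm]
        _ ≤ _ := Finset.card_le_card
          (Finset.subset_biUnion_of_mem (fun n : X => F n ×ˢ (Finset.univ : Finset (Fin k))) hn₀))
  -- Each of the `k` copies yields one partial injection, from the matched index of `γ` back to the
  -- index of `α`.
  let f : Fin k → Emb := fun j => embOfRel (fun m n => ∃ hn : α n ≠ 0, φ ⟨n, hn⟩ = (m, j))
    (by
      rintro m n n' ⟨hn, e⟩ ⟨hn', e'⟩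
      exact congrArg Subtype.val (hφ (e.trans e'.symm)))
    (by
      rintro m m' n ⟨hn, e⟩ ⟨hn', e'⟩
      exact congrArg Prod.fst (e.symm.trans e'))
  refine mem_of_norm_le_sum S (γ := fun j => push (f j) γ) (fun j => hS _ _ hγ) (C := 2 * C)
    (by positivity) fun n => ?_
  by_cases hn : α n = 0
  · rw [hn, norm_zero]
    exact mul_nonneg (by positivity) (Finset.sum_nonneg fun _ _ => norm_nonneg _)
  have h1 : ‖push (f (φ ⟨n, hn⟩).2) γ n‖ ≤ ∑ j, ‖push (f j) γ n‖ :=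
    Finset.single_le_sum (f := fun j => ‖push (f j) γ n‖) (fun _ _ => norm_nonneg _)
      (Finset.mem_univ _)
  rw [push_apply_of_eq_some (f := f (φ ⟨n, hn⟩).2) (embOfRel_eq_some.2 ⟨hn, rfl⟩)] at h1
  have h2 := (hF _ _).1 (Finset.mem_product.1 (hφF ⟨n, hn⟩)).1
  rw [div_lt_iff₀' (by positivity)] at h2
  exact h2.le.trans (mul_le_mul_of_nonneg_left h1 (by positivity))

/-! ### Diagonal operators in `J_S`: the dimension count. -/

theorem exists_sum_of_mem_idealJ {S : SymmetricIdeal} {T : BoundedOps} (hT : T ∈ idealJ S) :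
    ∃ (ι : Type) (_ : Fintype ι) (A B : ι → BoundedOps) (γ : ι → EllInfty),
      (∀ i, γ i ∈ S.1) ∧ T = ∑ i, A i * diag (γ i) * B i := by
  rw [idealJ, TwoSidedIdeal.mem_span_iff_mem_addSubgroup_closure] at hT
  induction hT using AddSubgroup.closure_induction with
  | mem T hT =>
    obtain ⟨_, ⟨A, -, _, ⟨γ, hγ, rfl⟩, rfl⟩, B, -, rfl⟩ := hT
    exact ⟨Unit, inferInstance, fun _ => A, fun _ => B, fun _ => γ, fun _ => hγ, by simp⟩
  | zero => exact ⟨Empty, inferInstance, Empty.elim, Empty.elim, Empty.elim, (·.elim), by simp⟩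
  | add T T' _ _ h h' =>
    obtain ⟨ι, _, A, B, γ, hγ, rfl⟩ := h
    obtain ⟨ι', _, A', B', γ', hγ', rfl⟩ := h'
    exact ⟨ι ⊕ ι', inferInstance, Sum.elim A A', Sum.elim B B', Sum.elim γ γ',
      by rintro (i | i) <;> simp [hγ, hγ'], by simp⟩
  | neg T _ h =>
    obtain ⟨ι, _, A, B, γ, hγ, rfl⟩ := h
    exact ⟨ι, inferInstance, -A, B, γ, hγ, by simp⟩

theorem norm_le_mul_norm_of_forall {x y : EllTwo} {t : ℝ} (ht : 0 ≤ t)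
    (h : ∀ n, ‖x n‖ ≤ t * ‖y n‖) : ‖x‖ ≤ t * ‖y‖ := by
  refine lp.norm_le_of_forall_sum_le (by norm_num) (by positivity) fun s => ?_
  rw [Real.mul_rpow ht (norm_nonneg _)]
  refine le_trans ?_ (mul_le_mul_of_nonneg_left (lp.sum_rpow_le_norm_rpow (by norm_num) y s)
    (by positivity))
  rw [Finset.mul_sum]
  refine Finset.sum_le_sum fun n _ => ?_
  rw [← Real.mul_rpow ht (norm_nonneg _)]
  exact Real.rpow_le_rpow (norm_nonneg _) (h n) (by positivity)

theorem mul_norm_lt_of_forall {x y : EllTwo} {t : ℝ} (ht : 0 < t) (hx : x ≠ 0)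
    (h : ∀ n, x n ≠ 0 → t * ‖x n‖ < ‖y n‖) : t * ‖x‖ < ‖y‖ := by
  have h2 : 0 < (2 : ℝ≥0∞).toReal := by norm_num
  rw [← Real.rpow_lt_rpow_iff (by positivity) (norm_nonneg _) h2,
    Real.mul_rpow ht.le (norm_nonneg _), lp.norm_rpow_eq_tsum h2, lp.norm_rpow_eq_tsum h2,
    ← tsum_mul_left]
  obtain ⟨n, hn⟩ : ∃ n, x n ≠ 0 := by
    by_contra! h0
    exact hx (lp.ext (funext h0))
  refine Summable.tsum_lt_tsum (i := n) (fun n => ?_) ?_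
    ((lp.memℓp x).summable h2 |>.mul_left _) ((lp.memℓp y).summable h2)
  · rw [← Real.mul_rpow ht.le (norm_nonneg _)]
    refine Real.rpow_le_rpow (by positivity) ?_ h2.le
    by_cases h0 : x n = 0
    · simp [h0]
    · exact (h n h0).le
  · rw [← Real.mul_rpow ht.le (norm_nonneg _)]
    exact Real.rpow_lt_rpow (by positivity) (h n hn) h2

/-- The coordinate functionals of `ℓ²`. -/
noncomputable def coordₗ (n : ℕ) : EllTwo →ₗ[ℂ] ℂ where
  toFun x := x n
  map_add' _ _ := rfl
  map_smul' _ _ := rfl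

/-- A finitely supported vector of `ℓ²`. -/
noncomputable def finVec (s : Finset ℕ) : (s → ℂ) →ₗ[ℂ] EllTwo :=
  ∑ i : s, (lp.lsingle (E := fun _ : ℕ => ℂ) 2 (i : ℕ)).comp (LinearMap.proj (R := ℂ) i)

theorem sum_apply_two {ι : Type*} (s : Finset ι) (a : ι → EllTwo) (n : ℕ) :
    (∑ i ∈ s, a i) n = ∑ i ∈ s, a i n := map_sum (coordₗ n) a s

theorem finVec_apply (s : Finset ℕ) (c : s → ℂ) (i : s) : finVec s c i = c i := by
  rw [finVec, LinearMap.sum_apply, sum_apply_two, Finset.sum_eq_single i]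
  · simp
  · intro j _ hj
    have : (i : ℕ) ≠ j := fun h => hj (Subtype.ext h.symm)
    simp [this]
  · simp

theorem finVec_apply_of_notMem (s : Finset ℕ) (c : s → ℂ) {n : ℕ} (hn : n ∉ s) :
    finVec s c n = 0 := by
  rw [finVec, LinearMap.sum_apply, sum_apply_two]
  refine Finset.sum_eq_zero fun j _ => ?_
  have : n ≠ j := fun h => hn (h ▸ j.2)
  simp [this]

theorem mem_of_diag_mem_idealJ {S : SymmetricIdeal} {α : EllInfty} (h : diag α ∈ idealJ S) :
    α ∈ S.1 := by
  obtain ⟨ι, _, A, B, γ, hγ, hα⟩ := exists_sum_of_mem_idealJ h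
  let δ : EllInfty := ofBound (fun n => ((∑ i, ‖γ i n‖ : ℝ) : ℂ)) (∑ i, ‖γ i‖) (fun n => by
    rw [Complex.norm_of_nonneg (Finset.sum_nonneg fun _ _ => norm_nonneg _)]
    exact Finset.sum_le_sum fun i _ => lp.norm_apply_le_norm ENNReal.top_ne_zero _ _)
  have hδn : ∀ n, ‖δ n‖ = ∑ i, ‖γ i n‖ := fun n =>
    Complex.norm_of_nonneg (Finset.sum_nonneg fun _ _ => norm_nonneg _)
  have hδ : δ ∈ S.1 := mem_of_norm_le_sum S.1 hγ zero_le_one fun n => by rw [hδn, one_mul]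
  have hnn : 0 ≤ ∑ i, ‖A i‖ * ‖B i‖ := Finset.sum_nonneg fun i _ => by positivity
  -- The summand `1` only keeps the constant positive.
  refine mem_of_card_le S.2 hδ (k := Fintype.card ι) (C := ∑ i, ‖A i‖ * ‖B i‖ + 1)
    (by positivity) fun t ht F hF s hs => ?_
  by_contra! hlt
  -- If `s` has more than `k * F.card` elements, some nonzero vector `x` supported on `s` has every
  -- `B i x` vanishing on `F`. Off `F` all `γ i` are at most `t`, so `diag α x` is too small for the
  -- lower bound on `α` over `s`.
  let L : (s → ℂ) →ₗ[ℂ] (ι × F → ℂ) :=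
    LinearMap.pi fun p => (coordₗ p.2).comp ((B p.1).toLinearMap.comp (finVec s))
  obtain ⟨c, hc, hc0⟩ : ∃ c ∈ LinearMap.ker L, c ≠ 0 := by
    refine Submodule.exists_mem_ne_zero_of_ne_bot (LinearMap.ker_ne_bot_of_finrank_lt ?_)
    simpa using hlt
  have hx0 : finVec s c ≠ 0 := by
    intro h0
    refine hc0 (funext fun i => ?_)
    rw [← finVec_apply s c i, h0]; rfl
  have hL : ∀ i, ∀ m ∈ F, B i (finVec s c) m = 0 := fun i m hm =>
    congrFun (LinearMap.mem_ker.1 hc) (i, ⟨m, hm⟩)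
  have hlow : (∑ i, ‖A i‖ * ‖B i‖ + 1) * t * ‖finVec s c‖ < ‖diag α (finVec s c)‖ := by
    refine mul_norm_lt_of_forall (by positivity) hx0 fun n hn => ?_
    rw [diag_apply, norm_mul]
    have hns : n ∈ s := by
      by_contra hns
      exact hn (finVec_apply_of_notMem s c hns)
    exact mul_lt_mul_of_pos_right (hs n hns) (norm_pos_iff.2 hn)
  have hup : ‖diag α (finVec s c)‖ ≤ (∑ i, ‖A i‖ * ‖B i‖) * t * ‖finVec s c‖ := by
    rw [hα, sum_apply, Finset.sum_mul, Finset.sum_mul]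
    refine norm_sum_le_of_le _ fun i _ => ?_
    have h1 : ‖diag (γ i) (B i (finVec s c))‖ ≤ t * ‖B i (finVec s c)‖ := by
      refine norm_le_mul_norm_of_forall ht.le fun n => ?_
      rw [diag_apply, norm_mul]
      by_cases hn : n ∈ F
      · simp [hL i n hn]
      · refine mul_le_mul_of_nonneg_right ?_ (norm_nonneg _)
        refine le_trans ?_ (hF n hn)
        rw [hδn]
        exact Finset.single_le_sum (f := fun j => ‖γ j n‖) (fun _ _ => norm_nonneg _)
          (Finset.mem_univ i)
    calc ‖A i (diag (γ i) (B i (finVec s c)))‖ ≤ ‖A i‖ * (t * (‖B i‖ * ‖finVec s c‖)) := by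
          refine (A i).le_of_opNorm_le_of_le le_rfl (h1.trans ?_)
          exact mul_le_mul_of_nonneg_left ((B i).le_opNorm _) ht.le
      _ = _ := by ring
  have := hup.trans_lt' hlow
  have hx : 0 < t * ‖finVec s c‖ := mul_pos ht (norm_pos_iff.2 hx0)
  nlinarith

/-! ### Matrix entries and the diagonal of an element of `I_S`. -/

/-- The standard basis vectors of `ℓ²`. -/
noncomputable def stdVec (n : ℕ) : EllTwo := lp.single 2 n 1

theorem stdVec_self (n : ℕ) : stdVec n n = 1 := 
  lp.single_apply_self (E := fun _ : ℕ => ℂ) 2 n 1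

theorem stdVec_of_ne {n m : ℕ} (h : m ≠ n) : stdVec n m = 0 := 
  lp.single_apply_ne (E := fun _ : ℕ => ℂ) 2 n 1 h

theorem ops_ext_stdVec {A B : BoundedOps} (h : ∀ n, A (stdVec n) = B (stdVec n)) : A = B := by
  refine ContinuousLinearMap.ext fun x => ?_
  have hx := lp.hasSum_single (p := 2) (by norm_num) x
  have he : ∀ n, lp.single 2 n (x n) = x n • stdVec n := fun n => by
    rw [stdVec, ← lp.single_smul, smul_eq_mul, mul_one]
  simp only [he] at hx
  refine (A.hasSum hx).unique ?_
  convert B.hasSum hx using 2 with n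
  simp [h]

theorem diag_stdVec (a : EllInfty) (n : ℕ) : diag a (stdVec n) = a n • stdVec n := by
  refine lp.ext (funext fun m => ?_)
  change a m * stdVec n m = a n * stdVec n m
  by_cases h : m = n
  · rw [h]
  · rw [stdVec_of_ne h, mul_zero, mul_zero]

theorem U_stdVec_of_eq_some {f : Emb} {n m : ℕ} (h : f n = some m) :
    U f (stdVec n) = stdVec m := by
  refine lp.ext (funext fun k => ?_)
  rw [U_apply]
  cases hk : f.symm k with
  | none =>
    refine (stdVec_of_ne ?_).symm
    rintro rfl
    rw [(PEquiv.eq_some_iff f).2 h] at hk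
    cases hk
  | some l =>
    have hl := (PEquiv.eq_some_iff f).1 hk
    change stdVec n l = _
    by_cases h0 : k = m
    · subst h0
      rw [f.inj hl h, stdVec_self, stdVec_self]
    · rw [stdVec_of_ne h0]
      refine stdVec_of_ne ?_
      rintro rfl
      exact h0 (Option.some_inj.1 (hl.symm.trans h))

theorem U_stdVec_of_eq_none {f : Emb} {n : ℕ} (h : f n = none) : U f (stdVec n) = 0 := by
  refine lp.ext (funext fun k => ?_)
  rw [U_apply]
  cases hk : f.symm k with
  | none => rfl
  | some l =>
    have hl := (PEquiv.eq_some_iff f).1 hk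
    change stdVec n l = 0
    refine stdVec_of_ne ?_
    rintro rfl
    rw [h] at hl
    cases hl

theorem norm_stdVec (n : ℕ) : ‖stdVec n‖ = 1 := by
  rw [stdVec, lp.norm_single (by norm_num), norm_one]

/-- The diagonal of `diag(a) U_f` is `a` times the bounded diagonal of `U_f`, so by linearity every
element of the span has its diagonal in `S`. -/
theorem diag_mem_diagSpan_iff {S : Ideal EllInfty} {α : EllInfty} :
    diag α ∈ diagSpan S ↔ α ∈ S := by
  refine ⟨fun h => ?_, fun h => Submodule.subset_span
    ⟨α, h, PEquiv.refl ℕ, by rw [U_refl, mul_one]⟩⟩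
  have key : ∀ T ∈ diagSpan S, ∃ δ ∈ S, ∀ n, T (stdVec n) n = δ n := by
    intro T hT
    induction hT using Submodule.span_induction with
    | mem T hT =>
      obtain ⟨a, ha, f, rfl⟩ := hT
      have hb : ∀ n, ‖U f (stdVec n) n‖ ≤ 1 := fun n => by
        rcases h : f n with _ | m
        · rw [U_stdVec_of_eq_none h]; simp
        · rw [U_stdVec_of_eq_some h]
          exact (lp.norm_apply_le_norm (by norm_num) _ _).trans (norm_stdVec m).le
      exact ⟨ofBound _ 1 hb * a, S.mul_mem_left _ ha, fun n => mul_comm _ _⟩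
    | zero => exact ⟨0, S.zero_mem, fun n => rfl⟩
    | add T T' _ _ h h' =>
      obtain ⟨δ, hδ, e⟩ := h
      obtain ⟨δ', hδ', e'⟩ := h'
      exact ⟨δ + δ', S.add_mem hδ hδ', fun n => congrArg₂ (· + ·) (e n) (e' n)⟩
    | smul c T _ h =>
      obtain ⟨δ, hδ, e⟩ := h
      exact ⟨c • δ, S.smul_of_tower_mem c hδ, fun n => congrArg (c * ·) (e n)⟩
  obtain ⟨δ, hδ, e⟩ := key _ h
  have : α = δ := lp.ext (funext fun n => by
    rw [← e n, diag_apply, stdVec_self, mul_one])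
  rwa [this]

/-! ### Cutting elements of `Γ^∞` into weighted partial permutations. -/

theorem exists_finset_support {T : BoundedOps} (hT : T ∈ diagSpan Set.univ) :
    ∃ s : Finset Emb, ∀ n m, T (stdVec n) m ≠ 0 → ∃ f ∈ s, f n = some m := by
  classical
  induction hT using Submodule.span_induction with
  | mem T hT =>
    obtain ⟨a, -, f, rfl⟩ := hT
    refine ⟨{f}, fun n m h => ⟨f, Finset.mem_singleton_self f, ?_⟩⟩
    rcases hf : f n with _ | k
    · refine absurd ?_ h
      change a m * U f (stdVec n) m = 0
      rw [U_stdVec_of_eq_none hf]; simp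
    · by_contra hne
      refine h ?_
      change a m * U f (stdVec n) m = 0
      rw [U_stdVec_of_eq_some hf, stdVec_of_ne (fun e => hne (by rw [e])), mul_zero]
  | zero => exact ⟨∅, fun n m h => absurd rfl h⟩
  | add T T' _ _ h h' =>
    obtain ⟨s, hs⟩ := h
    obtain ⟨s', hs'⟩ := h'
    refine ⟨s ∪ s', fun n m h => ?_⟩
    by_cases h0 : T (stdVec n) m = 0
    · obtain ⟨f, hf, e⟩ := hs' n m fun h1 => h (by
        change T (stdVec n) m + T' (stdVec n) m = 0
        rw [h0, h1, add_zero])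
      exact ⟨f, Finset.mem_union_right _ hf, e⟩
    · obtain ⟨f, hf, e⟩ := hs n m h0
      exact ⟨f, Finset.mem_union_left _ hf, e⟩
  | smul c T _ h =>
    obtain ⟨s, hs⟩ := h
    refine ⟨s, fun n m h => hs n m fun h0 => h ?_⟩
    change c * T (stdVec n) m = 0
    rw [h0, mul_zero]

/-- Greedy colouring of a relation on `ℕ` with boundedly many smaller neighbours. -/
theorem exists_coloring_of_card_lt {R : ℕ → ℕ → Prop} {N : ℕ} (s : ℕ → Finset ℕ)
    (hcard : ∀ n, (s n).card < N) (hs : ∀ n, ∀ m < n, R m n → m ∈ s n) :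
    ∃ c : ℕ → Fin N, ∀ n, ∀ m < n, R m n → c m ≠ c n := by
  classical
  have hex : ∀ n (c : ∀ m < n, Fin N), ∃ x : Fin N, ∀ m (hm : m < n), m ∈ s n → c m hm ≠ x := by
    intro n c
    -- The colours already used on `s n`. Elements not below `n` get a dummy colour, which does not
    -- affect the count: fewer than `N` colours are excluded.
    let t : Finset (Fin N) := (s n).attach.image
      fun m => if h : m.1 < n then c m.1 h else ⟨0, (Nat.zero_le _).trans_lt (hcard n)⟩
    obtain ⟨x, hx⟩ : ∃ x, x ∉ t := by
      by_contra! h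
      have h1 : t = Finset.univ := Finset.eq_univ_iff_forall.2 h
      have h2 : t.card ≤ (s n).card := Finset.card_image_le.trans (Finset.card_attach).le
      rw [h1, Finset.card_univ, Fintype.card_fin] at h2
      exact absurd h2 (hcard n).not_ge
    refine ⟨x, fun m hm hms e => hx (Finset.mem_image.2 ⟨⟨m, hms⟩, Finset.mem_attach _ _, ?_⟩)⟩
    rw [dif_pos hm, e]
  choose F hF using hex
  refine ⟨Nat.lt_wfRel.wf.fix F, fun n m hm hR => ?_⟩
  rw [Nat.lt_wfRel.wf.fix_eq F n]
  exact hF n (fun m _ => Nat.lt_wfRel.wf.fix F m) m hm (hs n m hm hR)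

/-- Given finitely many partial injections, `ℕ` can be coloured with finitely many colours such
that on every colour class the partial injections have disjoint values at distinct points. -/
theorem exists_coloring_emb (s : Finset Emb) :
    ∃ (N : ℕ) (c : ℕ → Fin N), ∀ f ∈ s, ∀ g ∈ s, ∀ n n' m, f n = some m → g n' = some m →
      c n = c n' → n = n' := by
  classical
  let R : ℕ → ℕ → Prop := fun n n' => ∃ f ∈ s, ∃ g ∈ s, ∃ m, f n = some m ∧ g n' = some m
  -- A conflict with `n` is a value at `n` of one of the at most `s.card ^ 2` composites "`g`, then
  -- the inverse of `f`". The default `0` at most adds a superfluous neighbour.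
  let t : ℕ → Finset ℕ := fun n => (s ×ˢ s).image fun p => ((p.1.trans p.2.symm) n).getD 0
  obtain ⟨c, hc⟩ := exists_coloring_of_card_lt (R := R) (N := (s ×ˢ s).card + 1) t
    (fun n => Nat.lt_succ_of_le Finset.card_image_le) (by
      rintro n n' - ⟨f, hf, g, hg, m, hfm, hgm⟩
      refine Finset.mem_image.2 ⟨(g, f), Finset.mk_mem_product hg hf, ?_⟩
      have : (g.trans f.symm) n = some n' :=
        (PEquiv.trans_eq_some g f.symm n n').2 ⟨m, hgm, (PEquiv.eq_some_iff f).2 hfm⟩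
      change ((g.trans f.symm) n).getD 0 = n'
      rw [this]; rfl)
  refine ⟨_, c, fun f hf g hg n n' m hfn hgn hcc => ?_⟩
  rcases lt_trichotomy n n' with h | h | h
  · exact absurd hcc (hc n' n h ⟨f, hf, g, hg, m, hfn, hgn⟩)
  · exact h
  · exact absurd hcc.symm (hc n n' h ⟨g, hg, f, hf, m, hgn, hfn⟩)

/-- An operator with at most one nonzero entry in each row and column is of the form
`diag(b) U_h`. -/
theorem exists_diag_mul_U {T : BoundedOps}
    (h₁ : ∀ n m m', T (stdVec n) m ≠ 0 → T (stdVec n) m' ≠ 0 → m = m')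
    (h₂ : ∀ n n' m, T (stdVec n) m ≠ 0 → T (stdVec n') m ≠ 0 → n = n') :
    ∃ (b : EllInfty) (h : Emb), T = diag b * U h ∧ diag b = T * U h.symm := by
  let h : Emb := embOfRel (fun n m => T (stdVec n) m ≠ 0) h₁ h₂
  have hsome : ∀ n m, h n = some m ↔ T (stdVec n) m ≠ 0 := fun n m => embOfRel_eq_some
  have hT : ∀ n m, h n = some m → T (stdVec n) = T (stdVec n) m • stdVec m := by
    intro n m hnm
    refine lp.ext (funext fun k => ?_)
    change _ = T (stdVec n) m * stdVec m k
    by_cases hk : k = m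
    · rw [hk, stdVec_self, mul_one]
    · rw [stdVec_of_ne hk, mul_zero]
      by_contra hne
      exact hk (h₁ n k m hne ((hsome n m).1 hnm))
  -- The weight `b` is the diagonal of `T * U h.symm`; the operator norm bounds it.
  have hbd : ∀ m, ‖(T * U h.symm) (stdVec m) m‖ ≤ ‖T * U h.symm‖ := fun m =>
    (lp.norm_apply_le_norm (by norm_num) _ _).trans (by
      simpa [norm_stdVec] using (T * U h.symm).le_opNorm (stdVec m))
  have hb : diag (ofBound _ _ hbd) = T * U h.symm := by
    refine ops_ext_stdVec fun m => ?_
    rw [diag_stdVec, ofBound_apply]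
    change T (U h.symm (stdVec m)) m • _ = T (U h.symm (stdVec m))
    rcases hm : h.symm m with _ | n
    · rw [U_stdVec_of_eq_none hm, map_zero]; simp
    · rw [U_stdVec_of_eq_some hm]
      exact (hT n m ((PEquiv.eq_some_iff h).1 hm)).symm
  refine ⟨_, h, ?_, hb⟩
  rw [hb, mul_assoc]
  refine ops_ext_stdVec fun n => ?_
  change _ = T (U h.symm (U h (stdVec n)))
  rcases hn : h n with _ | m
  · rw [U_stdVec_of_eq_none hn, map_zero, map_zero]
    refine lp.ext (funext fun k => ?_)
    by_contra hk
    rw [(hsome n k).2 hk] at hn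
    cases hn
  · rw [U_stdVec_of_eq_some hn, U_stdVec_of_eq_some ((PEquiv.eq_some_iff h).2 hn)]

/-- The indicator sequence of a colour class. -/
noncomputable def classInd {N : ℕ} (c : ℕ → Fin N) (i : Fin N) : EllInfty :=
  ofBound (fun n => if c n = i then 1 else 0) 1 (fun n => by split_ifs <;> simp)

theorem classInd_apply {N : ℕ} (c : ℕ → Fin N) (i : Fin N) (n : ℕ) :
    classInd c i n = if c n = i then 1 else 0 := rfl

theorem sum_diag_classInd {N : ℕ} (c : ℕ → Fin N) : ∑ i, diag (classInd c i) = 1 := by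
  refine ops_ext fun x n => ?_
  rw [sum_apply, sum_apply_two]
  simp only [diag_apply, classInd_apply, ite_mul, one_mul, zero_mul]
  simp

/-- Every element of `Γ^∞` is a finite sum of compressions that are of the form `diag(b) U_h`. -/
theorem exists_sum_compressions {T : BoundedOps} (hT : T ∈ diagSpan Set.univ) :
    ∃ (N M : ℕ) (p : Fin N → EllInfty) (q : Fin M → EllInfty),
      T = ∑ i, ∑ j, diag (p i) * T * diag (q j) ∧
      ∀ i j, ∃ (b : EllInfty) (h : Emb), diag (p i) * T * diag (q j) = diag b * U h ∧
        diag b = diag (p i) * T * diag (q j) * U h.symm := by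
  classical
  obtain ⟨s, hs⟩ := exists_finset_support hT
  -- Colouring with the inverses separates rows that meet a common column; `d` separates columns
  -- that meet a common row.
  obtain ⟨N, c, hc⟩ := exists_coloring_emb (s.image PEquiv.symm)
  obtain ⟨M, d, hd⟩ := exists_coloring_emb s
  refine ⟨N, M, classInd c, classInd d, ?_, fun i j => ?_⟩
  · simp_rw [← Finset.mul_sum, sum_diag_classInd, mul_one, ← Finset.sum_mul, sum_diag_classInd,
      one_mul]
  have hent : ∀ n m, (diag (classInd c i) * T * diag (classInd d j)) (stdVec n) m ≠ 0 →
      c m = i ∧ d n = j ∧ ∃ f ∈ s, f n = some m := by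
    intro n m h
    have e : (diag (classInd c i) * T * diag (classInd d j)) (stdVec n) m
        = (if c m = i then 1 else 0) * ((if d n = j then 1 else 0) * T (stdVec n) m) := by
      change classInd c i m * T (diag (classInd d j) (stdVec n)) m = _
      rw [diag_stdVec, map_smul]
      rfl
    rw [e] at h
    have h1 := right_ne_zero_of_mul h
    exact ⟨by simpa using left_ne_zero_of_mul h, by simpa using left_ne_zero_of_mul h1,
      hs n m (right_ne_zero_of_mul h1)⟩
  refine exists_diag_mul_U (fun n m m' h h' => ?_) (fun n n' m h h' => ?_)
  · obtain ⟨e₁, -, f, hf, hfm⟩ := hent _ _ h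
    obtain ⟨e₂, -, g, hg, hgm⟩ := hent _ _ h'
    exact hc _ (Finset.mem_image_of_mem _ hf) _ (Finset.mem_image_of_mem _ hg) m m' n
      ((PEquiv.eq_some_iff f).2 hfm) ((PEquiv.eq_some_iff g).2 hgm) (e₁.trans e₂.symm)
  · obtain ⟨-, e₁, f, hf, hfm⟩ := hent _ _ h
    obtain ⟨-, e₂, g, hg, hgm⟩ := hent _ _ h'
    exact hd f hf g hg n n' m hfm hgm (e₁.trans e₂.symm)

/-! ### The correspondence between symmetric ideals and ideals of `Γ^∞`. -/

theorem mem_idealI {S : SymmetricIdeal} {T : Gam} :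
    T ∈ idealI S ↔ (T : BoundedOps) ∈ diagSpan (S.1 : Set EllInfty) :=
  TwoSidedIdeal.mem_mk' _ _ _ _ _ _ T

theorem mem_symI {I : TwoSidedIdeal Gam} {a : EllInfty} : a ∈ (symI I).1 ↔ diagGam a ∈ I := Iff.rfl

theorem symI_idealI (S : SymmetricIdeal) : symI (idealI S) = S := by
  refine Subtype.ext (Ideal.ext fun a => ?_)
  rw [mem_symI, mem_idealI]
  exact diag_mem_diagSpan_iff

theorem idealI_symI (I : TwoSidedIdeal Gam) : idealI (symI I) = I := by
  refine TwoSidedIdeal.ext fun T => ?_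
  rw [mem_idealI]
  constructor
  · obtain ⟨T, hT⟩ := T
    intro h
    have key : ∀ T ∈ diagSpan ((symI I).1 : Set EllInfty), ∃ h : T ∈ Gam, (⟨T, h⟩ : Gam) ∈ I := by
      intro T hT
      induction hT using Submodule.span_induction with
      | mem T hT =>
        obtain ⟨a, ha, f, rfl⟩ := hT
        exact ⟨diag_mul_U_mem a f, I.mul_mem_right (diagGam a) ⟨U f, U_mem f⟩ (mem_symI.1 ha)⟩
      | zero => exact ⟨Gam.zero_mem, I.zero_mem⟩
      | add T T' _ _ h h' => exact ⟨Gam.add_mem h.1 h'.1, I.add_mem h.2 h'.2⟩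
      | smul c T _ h =>
        refine ⟨Gam.smul_mem h.1 c, ?_⟩
        have := I.mul_mem_left (algebraMap ℂ Gam c) _ h.2
        rwa [← Algebra.smul_def] at this
    exact (key T h).2
  · intro hT
    -- Each block is a compression of `T` by elements of `Γ^∞`, and multiplying it by `U h.symm`
    -- puts its weight `diag b` in `I`.
    obtain ⟨N, M, p, q, hsum, hpq⟩ := exists_sum_compressions T.2
    rw [hsum]
    refine Submodule.sum_mem _ fun i _ => Submodule.sum_mem _ fun j _ => ?_
    obtain ⟨b, h, e, hb⟩ := hpq i j
    rw [e]
    refine Submodule.subset_span ⟨b, ?_, h, rfl⟩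
    have : diagGam b = diagGam (p i) * T * diagGam (q j) * ⟨U h.symm, U_mem h.symm⟩ :=
      Subtype.ext hb
    change diagGam b ∈ I
    rw [this]
    exact I.mul_mem_right _ _ (I.mul_mem_right _ _ (I.mul_mem_left _ _ hT))

/-! ### Diagonalising an operator along an orthonormal sequence. -/

/-- Bessel's inequality for pairwise orthogonal vectors of norm at most one. -/
theorem sum_norm_inner_sq_le {f : ℕ → EllTwo} (hf : Pairwise fun m n => inner ℂ (f m) (f n) = 0)
    (hf₁ : ∀ n, ‖f n‖ ≤ 1) (x : EllTwo) (s : Finset ℕ) :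
    ∑ n ∈ s, ‖inner ℂ (f n) x‖ ^ 2 ≤ ‖x‖ ^ 2 := by
  set A := ∑ n ∈ s, ‖inner ℂ (f n) x‖ ^ 2 with hA
  have hA0 : 0 ≤ A := Finset.sum_nonneg fun _ _ => by positivity
  set y := ∑ n ∈ s, (inner ℂ (f n) x) • f n with hy
  -- Once `‖y‖ ^ 2 ≤ A` is known, Cauchy–Schwarz for this inner product gives `A ^ 2 ≤ A * ‖x‖ ^ 2`.
  have hyx : inner ℂ y x = (A : ℂ) := by
    rw [hy, sum_inner, hA]
    push_cast
    refine Finset.sum_congr rfl fun n _ => ?_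
    rw [inner_smul_left, Complex.conj_mul']
  have hyf : ∀ n ∈ s, inner ℂ y (f n) = star (inner ℂ (f n) x) * ‖f n‖ ^ 2 := by
    intro n hn
    rw [hy, sum_inner, Finset.sum_eq_single n]
    · rw [inner_smul_left, inner_self_eq_norm_sq_to_K]; rfl
    · intro m _ hmn
      rw [inner_smul_left, hf hmn, mul_zero]
    · exact fun h => absurd hn h
  have hyy : ‖y‖ ^ 2 ≤ A := by
    have h1 : ((‖y‖ ^ 2 : ℝ) : ℂ) = ((∑ n ∈ s, ‖inner ℂ (f n) x‖ ^ 2 * ‖f n‖ ^ 2 : ℝ) : ℂ) := by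
      have h2 : inner ℂ y y = ∑ n ∈ s, (inner ℂ (f n) x) * (inner ℂ y (f n)) := by
        conv_lhs => rw [hy, inner_sum]
        exact Finset.sum_congr rfl fun n _ => inner_smul_right _ _ _
      have h3 : inner ℂ y y = ((‖y‖ ^ 2 : ℝ) : ℂ) := by
        rw [inner_self_eq_norm_sq_to_K]; push_cast; rfl
      rw [← h3, h2]
      push_cast
      refine Finset.sum_congr rfl fun n hn => ?_
      rw [hyf n hn, ← mul_assoc]
      congr 1
      exact Complex.mul_conj' _
    rw [Complex.ofReal_inj] at h1
    rw [h1]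
    refine Finset.sum_le_sum fun n _ => mul_le_of_le_one_right (by positivity) ?_
    exact pow_le_one₀ (norm_nonneg _) (hf₁ n)
  have h4 : A ≤ ‖y‖ * ‖x‖ := by
    have := norm_inner_le_norm (𝕜 := ℂ) y x
    rwa [hyx, Complex.norm_of_nonneg hA0] at this
  have h5 : A * A ≤ A * ‖x‖ ^ 2 := calc
    A * A ≤ (‖y‖ * ‖x‖) * (‖y‖ * ‖x‖) := mul_self_le_mul_self hA0 h4
    _ = ‖y‖ ^ 2 * ‖x‖ ^ 2 := by ring
    _ ≤ A * ‖x‖ ^ 2 := mul_le_mul_of_nonneg_right hyy (by positivity)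
  rcases hA0.eq_or_lt with h | h
  · rw [← h]; positivity
  · exact le_of_mul_le_mul_left h5 h

/-- The operator `x ↦ (inner fₙ x)ₙ` of an orthogonal sequence of vectors of norm at most one. -/
noncomputable def coordOp (f : ℕ → EllTwo) (hf : Pairwise fun m n => inner ℂ (f m) (f n) = 0)
    (hf₁ : ∀ n, ‖f n‖ ≤ 1) : BoundedOps :=
  have h : ∀ x : EllTwo, ∀ s : Finset ℕ,
      ∑ n ∈ s, ‖inner ℂ (f n) x‖ ^ (2 : ℝ≥0∞).toReal ≤ ‖x‖ ^ (2 : ℝ≥0∞).toReal := fun x s => by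
    simpa using sum_norm_inner_sq_le hf hf₁ x s
  LinearMap.mkContinuous
    { toFun := fun x => ⟨fun n => inner ℂ (f n) x, memℓp_gen' (h x)⟩
      map_add' := fun x y => Subtype.ext (funext fun n => inner_add_right _ _ _)
      map_smul' := fun c x => Subtype.ext (funext fun n => inner_smul_right _ _ _) }
    1 (fun x => by
      rw [one_mul]
      exact lp.norm_le_of_forall_sum_le (by norm_num) (norm_nonneg _) (h x))

variable {f : ℕ → EllTwo} {hf : Pairwise fun m n => inner ℂ (f m) (f n) = 0}
  {hf₁ : ∀ n, ‖f n‖ ≤ 1}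

theorem coordOp_apply (x : EllTwo) (n : ℕ) : coordOp f hf hf₁ x n = inner ℂ (f n) x := rfl

theorem adjoint_coordOp_stdVec (n : ℕ) :
    ContinuousLinearMap.adjoint (coordOp f hf hf₁) (stdVec n) = f n := by
  refine ext_inner_right ℂ fun x => ?_
  rw [ContinuousLinearMap.adjoint_inner_left, stdVec, lp.inner_single_left, coordOp_apply]
  simp

/-- If `T` maps an orthonormal sequence to an orthogonal sequence, the diagonal operator of the
norms of the images is equivalent to `T` on the span of the sequence. -/
theorem exists_diag_norm_image (T : BoundedOps) (x : ℕ → EllTwo) (hx : Orthonormal ℂ x)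
    (hTx : Pairwise fun m n => inner ℂ (T (x m)) (T (x n)) = 0) :
    ∃ (s : EllInfty) (A B C D : BoundedOps), (∀ n, s n = ‖T (x n)‖) ∧ diag s = A * T * B ∧
      (∀ n, (C * diag s * D) (x n) = T (x n)) := by
  have hx0 : Pairwise fun m n => inner ℂ (x m) (x n) = 0 := hx.2
  let X := coordOp x hx0 (fun n => (hx.1 n).le)
  -- The vector `f n` is `0` when `T (x n) = 0`; this is why Bessel's inequality is needed for norms
  -- at most one.
  let f : ℕ → EllTwo := fun n => ((‖T (x n)‖⁻¹ : ℝ) : ℂ) • T (x n)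
  have hf : Pairwise fun m n => inner ℂ (f m) (f n) = 0 := fun m n hmn => by
    simp only [f, inner_smul_left, inner_smul_right]
    rw [hTx hmn, mul_zero, mul_zero]
  have hf₁ : ∀ n, ‖f n‖ ≤ 1 := fun n => by
    simp only [f, norm_smul, Complex.norm_real, norm_inv, norm_norm]
    exact inv_mul_le_one
  let F := coordOp f hf hf₁
  let s : EllInfty := ofBound (fun n => (‖T (x n)‖ : ℂ)) ‖T‖ fun n => by
    simpa [hx.1 n] using T.le_opNorm (x n)
  -- `X` sends `x n` to the basis vector `stdVec n`, `F` sends `T (x n)` to `‖T (x n)‖ • stdVec n`,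
  -- and their adjoints send `stdVec n` to `x n` and `f n`.
  refine ⟨s, F, ContinuousLinearMap.adjoint X, ContinuousLinearMap.adjoint F, X, fun n => rfl,
    ops_ext_stdVec fun n => ?_, fun n => ?_⟩
  · change _ = F (T (ContinuousLinearMap.adjoint X (stdVec n)))
    rw [diag_stdVec, adjoint_coordOp_stdVec]
    refine lp.ext (funext fun m => ?_)
    change (‖T (x n)‖ : ℂ) * stdVec n m = inner ℂ (f m) (T (x n))
    simp only [f, inner_smul_left, Complex.conj_ofReal]
    by_cases hmn : m = n
    · subst hmn
      rw [stdVec_self, inner_self_eq_norm_sq_to_K]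
      by_cases h0 : (‖T (x m)‖ : ℂ) = 0
      · simp [h0]
      · push_cast
        field_simp
        rfl
    · rw [stdVec_of_ne hmn, hTx hmn, mul_zero, mul_zero]
  · have hX : X (x n) = stdVec n := by
      refine lp.ext (funext fun m => ?_)
      change inner ℂ (x m) (x n) = _
      by_cases hmn : m = n
      · subst hmn
        rw [stdVec_self, inner_self_eq_norm_sq_to_K, hx.1]; simp
      · rw [stdVec_of_ne hmn, hx0 hmn]
    change ContinuousLinearMap.adjoint F (diag s (X (x n))) = _
    rw [hX, diag_stdVec, map_smul, adjoint_coordOp_stdVec]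
    change (‖T (x n)‖ : ℂ) • ((‖T (x n)‖⁻¹ : ℝ) : ℂ) • T (x n) = _
    by_cases h0 : T (x n) = 0
    · simp [h0]
    · rw [smul_smul, ← Complex.ofReal_mul, mul_inv_cancel₀ (norm_ne_zero_iff.2 h0),
        Complex.ofReal_one, one_smul]

/-! ### Non-compact operators generate everything. -/

/-- Otherwise `T` would be arbitrarily small on orthogonal complements of finite-dimensional
subspaces `F`, hence a norm limit of the finite-rank operators `T ∘L F.starProjection`. -/
theorem exists_lower_bound_of_not_compact {T : BoundedOps} (hT : ¬ IsCompactOperator T) :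
    ∃ ε > 0, ∀ F : Submodule ℂ EllTwo, FiniteDimensional ℂ F →
      ∃ x ∈ Fᗮ, ‖x‖ = 1 ∧ ε ≤ ‖T x‖ := by
  by_contra! h
  refine hT ?_
  refine isClosed_setOfPred_isCompactOperator.closure_subset
    (Metric.mem_closure_iff.2 fun ε hε => ?_)
  obtain ⟨F, hF, hFx⟩ := h (ε / 2) (by positivity)
  refine ⟨T ∘L F.starProjection, ?_, ?_⟩
  · have : (⇑(T ∘L F.starProjection)) = (T ∘L F.subtypeL) ∘ F.orthogonalProjectionOnto := rfl
    change IsCompactOperator (⇑(T ∘L F.starProjection))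
    rw [this]
    have hF' : LocallyCompactSpace F := by
      have := FiniteDimensional.proper ℂ F
      infer_instance
    exact (isCompactOperator_of_locallyCompactSpace_rng (T ∘L F.subtypeL)).comp_clm _
  · rw [dist_eq_norm]
    refine (ContinuousLinearMap.opNorm_le_bound _ (by positivity) fun x => ?_).trans_lt
      (half_lt_self hε)
    have hP := F.sub_starProjection_mem_orthogonal x
    set z := x - F.starProjection x with hz
    have hzx : ‖z‖ ≤ ‖x‖ := by
      rw [hz, ← Submodule.starProjection_orthogonal_val]
      exact Fᗮ.norm_starProjection_apply_le x
    have e : (T - T ∘L F.starProjection) x = T z := by simp [hz]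
    rw [e]
    by_cases h0 : z = 0
    · rw [h0, map_zero, norm_zero]; positivity
    have h1 := hFx (((‖z‖⁻¹ : ℝ) : ℂ) • z) (Submodule.smul_mem _ _ hP) (by
      rw [norm_smul, Complex.norm_real, norm_inv, norm_norm,
        inv_mul_cancel₀ (norm_ne_zero_iff.2 h0)])
    rw [map_smul, norm_smul, Complex.norm_real, norm_inv, norm_norm,
      inv_mul_lt_iff₀ (norm_pos_iff.2 h0), mul_comm] at h1
    exact h1.le.trans (mul_le_mul_of_nonneg_left hzx (by positivity))

/-- `T` is bounded below along an orthonormal sequence with orthogonal images, so the diagonal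
operator of the norms of the images lies in `J` and is invertible. -/
theorem one_mem_of_not_compact {J : TwoSidedIdeal BoundedOps} {T : BoundedOps} (hTJ : T ∈ J)
    (hT : ¬ IsCompactOperator T) : (1 : BoundedOps) ∈ J := by
  classical
  obtain ⟨ε, hε, h⟩ := exists_lower_bound_of_not_compact hT
  obtain ⟨x, hx, hxr⟩ := exists_seq_of_forall_finset_exists
    (fun x : EllTwo => ‖x‖ = 1 ∧ ε ≤ ‖T x‖)
    (fun x y => inner ℂ x y = 0 ∧ inner ℂ (T x) (T y) = 0) (by
      intro s _
      -- Orthogonality of the next vector to `T* T x` makes its image orthogonal to `T x`.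
      let t : Finset EllTwo := s ∪ s.image fun x => ContinuousLinearMap.adjoint T (T x)
      obtain ⟨y, hy, hy'⟩ := h (Submodule.span ℂ (t : Set EllTwo)) inferInstance
      refine ⟨y, hy', fun x hx => ⟨?_, ?_⟩⟩
      · exact (Submodule.mem_orthogonal _ _).1 hy x (Submodule.subset_span
          (Finset.mem_union_left _ hx))
      · rw [← ContinuousLinearMap.adjoint_inner_left]
        exact (Submodule.mem_orthogonal _ _).1 hy _ (Submodule.subset_span
          (Finset.mem_union_right _ (Finset.mem_image_of_mem _ hx))))
  have hsymm : ∀ g : ℕ → EllTwo, (∀ m n, m < n → inner ℂ (g m) (g n) = 0) →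
      Pairwise fun m n => inner ℂ (g m) (g n) = 0 := fun g hg m n hmn => by
    rcases hmn.lt_or_gt with h | h
    · exact hg m n h
    · exact inner_eq_zero_symm.1 (hg n m h)
  obtain ⟨s, A, B, -, -, hs, hAB, -⟩ := exists_diag_norm_image T x
    ⟨fun n => (hx n).1, hsymm x fun m n h => (hxr m n h).1⟩
    (hsymm (fun n => T (x n)) fun m n h => (hxr m n h).2)
  let r : EllInfty := ofBound (fun n => (s n)⁻¹) ε⁻¹ fun n => by
    rw [norm_inv, hs, Complex.norm_real, norm_norm]
    exact inv_anti₀ hε (hx n).2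
  have hrs : r * s = 1 := lp.ext (funext fun n => by
    refine inv_mul_cancel₀ ?_
    rw [hs]
    exact Complex.ofReal_ne_zero.2 (hε.trans_le (hx n).2).ne')
  rw [← diag_one, ← hrs, diag_mul, hAB]
  exact J.mul_mem_left _ _ (J.mul_mem_right _ _ (J.mul_mem_left _ _ hTJ))

/-! ### Singular values of compact operators. -/

/-- By Bessel's inequality each coordinate is nonzero on only countably many of the vectors, and
every vector has a nonzero coordinate. -/
theorem countable_of_orthonormal {ι : Type*} {v : ι → EllTwo} (hv : Orthonormal ℂ v) :
    Countable ι := by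
  have h : ∀ n, {i | v i n ≠ 0}.Countable := fun n => by
    refine (hv.inner_products_summable (stdVec n)).countable_support.mono fun i hi => ?_
    rw [Function.mem_support, stdVec, lp.inner_single_right]
    simpa using hi
  rw [← Set.countable_univ_iff]
  refine (Set.countable_iUnion h).mono fun i _ => ?_
  rw [Set.mem_iUnion]
  by_contra! h0
  have : v i = 0 := lp.ext (funext fun n => not_not.1 (h0 n))
  exact hv.ne_zero i this

theorem not_finiteDimensional : ¬ FiniteDimensional ℂ EllTwo := by
  intro _
  have hli : LinearIndependent ℂ stdVec := by
    refine linearIndependent_of_ne_zero_of_inner_eq_zero (𝕜 := ℂ)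
      (fun n h => by simpa [h] using norm_stdVec n) fun m n hmn => ?_
    change inner ℂ (lp.single 2 m (1 : ℂ)) (stdVec n) = 0
    rw [lp.inner_single_left, stdVec_of_ne hmn, inner_zero_right]
  exact not_finite_iff_infinite.2 inferInstance hli.finite

/-- This allows an eigenbasis to be indexed by `ℕ`. A finite family would have a closed span, making
`ℓ²` finite-dimensional. -/
theorem exists_equiv_nat_of_dense {ι : Type*} {v : ι → EllTwo} (hv : Orthonormal ℂ v)
    (hvd : Dense (Submodule.span ℂ (Set.range v) : Set EllTwo)) : Nonempty (ℕ ≃ ι) := by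
  have := countable_of_orthonormal hv
  have : Infinite ι := by
    rw [← not_finite_iff_infinite]
    intro hfin
    have h1 : FiniteDimensional ℂ (Submodule.span ℂ (Set.range v)) :=
      FiniteDimensional.span_of_finite ℂ (Set.finite_range v)
    have h2 : Submodule.span ℂ (Set.range v) = ⊤ := by
      rw [← Submodule.dense_iff_topologicalClosure_eq_top.1 hvd,
        (Submodule.closed_of_finiteDimensional _).submodule_topologicalClosure_eq]
    rw [h2] at h1
    exact not_finiteDimensional (Module.Finite.equiv Submodule.topEquiv)
  exact nonempty_equiv_of_countable

theorem exists_orthonormal_dense_span (K : Type u) [NormedAddCommGroup K] [InnerProductSpace ℂ K]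
    [CompleteSpace K] : ∃ (w : Type u) (b : w → K), Orthonormal ℂ b ∧
      Dense (Submodule.span ℂ (Set.range b) : Set K) := by
  obtain ⟨w, b, -⟩ := exists_hilbertBasis ℂ K
  exact ⟨w, b, b.orthonormal, Submodule.dense_iff_topologicalClosure_eq_top.2 b.dense_span⟩

/-- A compact self-adjoint operator has a complete orthonormal family of eigenvectors. -/
theorem exists_orthonormal_eigenvectors {H : Type u} [NormedAddCommGroup H]
    [InnerProductSpace ℂ H] [CompleteSpace H] {A : H →L[ℂ] H} (hA : IsCompactOperator A)
    (hA' : A.toLinearMap.IsSymmetric) :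
    ∃ (ι : Type u) (v : ι → H) (μ : ι → ℂ), Orthonormal ℂ v ∧
      Dense (Submodule.span ℂ (Set.range v) : Set H) ∧ ∀ i, A (v i) = μ i • v i := by
  have hc : ∀ μ, CompleteSpace (Module.End.eigenspace (A : Module.End ℂ H) μ) := fun μ =>
    (ContinuousLinearMap.isClosed_eigenspace A μ).completeSpace_coe
  choose w b hb hbd using fun μ =>
    exists_orthonormal_dense_span (Module.End.eigenspace (A : Module.End ℂ H) μ)
  refine ⟨Σ μ, w μ, fun i => (b i.1 i.2 : H), fun i => i.1,
    hA'.orthogonalFamily_eigenspaces.orthonormal_sigma_orthonormal hb,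
    ?_, fun i => Module.End.mem_eigenspace_iff.1 (b i.1 i.2).2⟩
  -- A vector orthogonal to all chosen eigenvectors is orthogonal to every eigenspace, by density of
  -- the spans there, and so vanishes by the spectral theorem.
  rw [Submodule.dense_iff_topologicalClosure_eq_top, Submodule.topologicalClosure_eq_top_iff,
    eq_bot_iff, ← ContinuousLinearMap.orthogonalComplement_iSup_eigenspaces_eq_bot hA hA']
  intro x hx
  rw [← Submodule.iInf_orthogonal, Submodule.mem_iInf]
  intro μ
  rw [Submodule.mem_orthogonal']
  intro u hu
  have h1 : (innerSL ℂ x) ∘L (Module.End.eigenspace (A : Module.End ℂ H) μ).subtypeL = 0 := by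
    refine ContinuousLinearMap.ext_on (hbd μ) ?_
    rintro _ ⟨i, rfl⟩
    exact (Submodule.mem_orthogonal' _ _).1 hx _ (Submodule.subset_span ⟨⟨μ, i⟩, rfl⟩)
  exact DFunLike.congr_fun h1 ⟨u, hu⟩

/-- A compact self-adjoint operator of `ℓ²` has an orthonormal basis of eigenvectors. -/
theorem exists_eigenbasis {A : BoundedOps} (hA : IsCompactOperator A)
    (hA' : A.toLinearMap.IsSymmetric) :
    ∃ (x : ℕ → EllTwo) (μ : ℕ → ℂ), Orthonormal ℂ x ∧
      Dense (Submodule.span ℂ (Set.range x) : Set EllTwo) ∧ ∀ n, A (x n) = μ n • x n := by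
  obtain ⟨ι, v, μ, hv, hvd, hμ⟩ := exists_orthonormal_eigenvectors hA hA'
  obtain ⟨e⟩ := exists_equiv_nat_of_dense hv hvd
  refine ⟨v ∘ e, μ ∘ e, hv.comp e e.injective, ?_, fun n => hμ (e n)⟩
  rwa [e.surjective.range_comp]

/-- Every compact operator is equivalent to a diagonal operator. -/
theorem exists_diag_of_compact {T : BoundedOps} (hT : IsCompactOperator T) :
    ∃ (s : EllInfty) (A B C D : BoundedOps), diag s = A * T * B ∧ T = C * diag s * D := by
  -- Orthogonal eigenvectors of `T* T` have orthogonal images under `T`, so `s` is the sequence of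
  -- singular values.
  obtain ⟨x, μ, hx, hxd, hμ⟩ := exists_eigenbasis
    (A := ContinuousLinearMap.adjoint T ∘L T) (hT.clm_comp (ContinuousLinearMap.adjoint T))
    (fun y z => by
      change inner ℂ (ContinuousLinearMap.adjoint T (T y)) z =
        inner ℂ y (ContinuousLinearMap.adjoint T (T z))
      rw [ContinuousLinearMap.adjoint_inner_left, ContinuousLinearMap.adjoint_inner_right])
  obtain ⟨s, A, B, C, D, -, hAB, hCD⟩ := exists_diag_norm_image T x hx fun m n hmn => by
    change inner ℂ (T (x m)) (T (x n)) = 0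
    rw [← ContinuousLinearMap.adjoint_inner_right]
    have := hμ n
    rw [ContinuousLinearMap.comp_apply] at this
    rw [this, inner_smul_right, hx.2 hmn, mul_zero]
  refine ⟨s, A, B, C, D, hAB, ContinuousLinearMap.ext_on hxd ?_⟩
  rintro _ ⟨n, rfl⟩
  exact (hCD n).symm

/-! ### The correspondence between ideals of bounded operators and ideals of `Γ^∞`. -/

theorem diag_mem_idealJ {S : SymmetricIdeal} {a : EllInfty} (ha : a ∈ S.1) : diag a ∈ idealJ S :=
  TwoSidedIdeal.subset_span ⟨a, ha, rfl⟩

/-- Ideals of `Γ^∞` are determined by their diagonal operators, so only these need comparison. -/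
theorem restrict_idealJ (S : SymmetricIdeal) : restrict (idealJ S) = idealI S := by
  rw [← idealI_symI (restrict (idealJ S))]
  congr 1
  refine Subtype.ext (Ideal.ext fun a => ?_)
  rw [mem_symI]
  exact ⟨mem_of_diag_mem_idealJ, diag_mem_idealJ⟩

theorem generate_idealI (S : SymmetricIdeal) : generate (idealI S) = idealJ S := by
  refine le_antisymm (TwoSidedIdeal.span_le.2 ?_) (TwoSidedIdeal.span_le.2 ?_)
  · rintro _ ⟨x, hx, rfl⟩
    rw [← restrict_idealJ] at hx
    exact hx
  · rintro _ ⟨a, ha, rfl⟩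
    exact TwoSidedIdeal.subset_span ⟨diagGam a, mem_idealI.2 (diag_mem_diagSpan_iff.2 ha), rfl⟩

theorem restrict_generate (I : TwoSidedIdeal Gam) : restrict (generate I) = I := by
  rw [← idealI_symI I, generate_idealI, restrict_idealJ]

/-- Each `T ∈ J` is recovered from `J ∩ Γ^∞`: through its singular values if compact, and through
`1` otherwise. -/
theorem generate_restrict (J : TwoSidedIdeal BoundedOps) : generate (restrict J) = J := by
  refine le_antisymm (TwoSidedIdeal.span_le.2 ?_) fun T hT => ?_
  · rintro _ ⟨x, hx, rfl⟩
    exact hx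
  · by_cases hc : IsCompactOperator T
    · obtain ⟨s, A, B, C, D, hAB, hCD⟩ := exists_diag_of_compact hc
      rw [hCD]
      refine TwoSidedIdeal.mul_mem_right _ _ _ (TwoSidedIdeal.mul_mem_left _ _ _ ?_)
      refine TwoSidedIdeal.subset_span ⟨diagGam s, ?_, rfl⟩
      change diag s ∈ J
      rw [hAB]
      exact J.mul_mem_right _ _ (J.mul_mem_left _ _ hT)
    · have h1 : (1 : BoundedOps) ∈ generate (restrict J) :=
        TwoSidedIdeal.subset_span ⟨1, one_mem_of_not_compact hT hc, rfl⟩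
      have := (generate (restrict J)).mul_mem_left T _ h1
      rwa [mul_one] at this

end GammaInfty

theorem theorem4p2 :
    (Function.Bijective GammaInfty.idealI ∧
      (∀ I : TwoSidedIdeal GammaInfty.Gam, GammaInfty.idealI (GammaInfty.symI I) = I) ∧
      (∀ S : GammaInfty.SymmetricIdeal, GammaInfty.symI (GammaInfty.idealI S) = S)) ∧
    (Function.Bijective GammaInfty.restrict ∧
      (∀ I : TwoSidedIdeal GammaInfty.Gam,
        GammaInfty.restrict (GammaInfty.generate I) = I) ∧
      (∀ J : TwoSidedIdeal GammaInfty.BoundedOps,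
        GammaInfty.generate (GammaInfty.restrict J) = J)) ∧
    (∀ S : GammaInfty.SymmetricIdeal,
      GammaInfty.restrict (GammaInfty.idealJ S) = GammaInfty.idealI S) :=
  ⟨⟨Function.bijective_iff_has_inverse.2
      ⟨_, GammaInfty.symI_idealI, GammaInfty.idealI_symI⟩,
    GammaInfty.idealI_symI, GammaInfty.symI_idealI⟩,
   ⟨Function.bijective_iff_has_inverse.2
      ⟨_, GammaInfty.generate_restrict, GammaInfty.restrict_generate⟩,
    GammaInfty.restrict_generate, GammaInfty.generate_restrict⟩,
   GammaInfty.restrict_idealJ⟩
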